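/- All graphs are finite and simple. A \emph{cograph} is a graph with no induced path on four vertices. Let $G=(V,E)$ be a cograph and let $T$ be its \emph{cotree}: the rooted tree whose leaves are the vertices of $G$, whose internal nodes are labelled \emph{parallel} or \emph{series}, have at least two children each, and are such that no two adjacent nodes have the same label, and in which two distinct vertices of $G$ are adjacent iff their lowest common ancestor is a series node. For a node $u$ of $T$, let $V(u)$ be the set of leaves of the subtree rooted at $u$ (so $V(u)=\{u\}$ if $u$ is a leaf). Let $x\notin V$ be a new vertex, let $N(x)\subseteq V$, and let $G+x$ be the graph obtained from $G$ by adding $x$ with neighbourhood $N(x)$. For $N\subseteq V$, a node $u$ is \emph{full} w.r.t. $N$ if $V(u)\subseteq N$, \emph{hollow} if $V(u)\cap N=\varnothing$, \emph{uniform} if it is full or hollow, and \emph{mixed} otherwise; when no set is mentioned, $N=N(x)$ is meant. A \emph{constrained completion} of $G+x$ is a cograph $H$ obtained from $G+x$ by adding only edges incident to $x$; it is \emph{minimal} if it is minimal for inclusion of edge sets among the constrained completions. A node $u$ is the \emph{insertion node} associated to a constrained completion $H$ if, for $N'=N_H(x)$, the node $u$ is mixed w.r.t. $N'$, all children of $u$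 are uniform w.r.t. $N'$, and for all $y\in V\setminus V(u)$ one has $y\in N'$ iff the lowest common ancestor of $y$ and $u$ is a series node. A node $u$ is a \emph{completion-minimal insertion node} if it is the insertion node associated to some minimal constrained completion of $G+x$. A node $u$ is \emph{eligible} if, for every strict ancestor $v$ of $u$ that is a parallel node, all children of $v$ other than the one that is $u$ or an ancestor of $u$ are hollow. The \emph{completion-forced} nodes are defined inductively: $u$ is completion-forced iff $u$ is full, or $u$ is a parallel node all of whose children are non-hollow, or $u$ is a series node all of whose children are completion-forced. \textbf{Lemma.} A node $u$ of $T$ is a completion-minimal insertion node if and only if $u$ is eligible, non-hollow and non-completion-forced, and in addition one of the following two conditions holds: \begin{enumerate} \item $u$ is a series node and has at least one hollow child; or \item $u$ is a parallel node and has no child that is both eligible and non-completion-forced. \end{enumerate} -/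

import Mathlib

/-- A graph is a cograph if it has no induced path on four vertices. -/
def IsCograph {V : Type*} (G : SimpleGraph V) : Prop :=
  ¬ (SimpleGraph.pathGraph 4).IsIndContained G

/-- The kind of a cotree node: a leaf, a parallel node or a series node. -/
inductive NodeKind where
  | leaf
  | parallel
  | series

/-- A cotree of the graph `G`. The underlying rooted tree is ordered from the root `⊥` downwards:
`v ≤ u` means that `v` is an ancestor of `u` (possibly `u` itself), `u ⋖ v` means that `v` is a
child of `u`, and `u ⊓ v` is the lowest common ancestor of `u` and `v`. -/
structure Cotree.{u, v} {V : Type u} (G : SimpleGraph V) where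
  /-- the underlying rooted tree -/
  tree : RootedTree.{v}
  /-- the tree is finite -/
  finite_tree : Finite tree
  /-- the kind of each node -/
  kind : tree → NodeKind
  /-- the leaf that carries a given vertex of `G` -/
  leaf : V → tree
  /-- distinct vertices are carried by distinct leaves -/
  leaf_injective : Function.Injective leaf
  /-- the nodes of kind `leaf` are those that carry a vertex -/
  kind_eq_leaf_iff : ∀ u : tree, kind u = NodeKind.leaf ↔ ∃ x : V, leaf x = u
  /-- a leaf has no child -/
  not_covBy_of_leaf : ∀ u v : tree, kind u = NodeKind.leaf → ¬ u ⋖ v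
  /-- every internal node has at least two children -/
  two_children : ∀ u : tree, kind u ≠ NodeKind.leaf → ∃ v w : tree, u ⋖ v ∧ u ⋖ w ∧ v ≠ w
  /-- no two parallel nodes and no two series nodes are adjacent in the tree -/
  kind_ne_of_covBy : ∀ u v : tree, u ⋖ v → kind u ≠ kind v
  /-- two vertices are adjacent iff their lowest common ancestor is a series node -/
  adj_iff : ∀ x y : V, x ≠ y → (G.Adj x y ↔ kind (leaf x ⊓ leaf y) = NodeKind.series)

/-- The graph `G + x`, where the new vertex `x = none` has neighbourhood `N`. -/
def addVertex {V : Type*} (G : SimpleGraph V) (N : Set V) : SimpleGraph (Option V) where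
  Adj
    | some a, some b => G.Adj a b
    | none, some b => b ∈ N
    | some a, none => a ∈ N
    | none, none => False
  symm := ⟨by
    rintro (_ | a) (_ | b) h
    · exact h
    · exact h
    · exact h
    · exact G.adj_symm h⟩
  loopless := ⟨by
    rintro (_ | a) h
    · exact h
    · exact G.loopless.irrefl a h⟩

/-- `H` is a constrained cograph completion of `G + x`: a cograph obtained from `G + x` by adding
only edges incident to `x = none`. -/
def IsConstrainedCompletion {V : Type*} (G : SimpleGraph V) (N : Set V)
    (H : SimpleGraph (Option V)) : Prop :=
  IsCograph H ∧ addVertex G N ≤ H ∧ ∀ a b : V, H.Adj (some a) (some b) → G.Adj a b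

/-- `H` is an inclusion-minimal constrained cograph completion of `G + x`. -/
def IsMinimalConstrainedCompletion {V : Type*} (G : SimpleGraph V) (N : Set V)
    (H : SimpleGraph (Option V)) : Prop :=
  Minimal (IsConstrainedCompletion G N) H

/-- The neighbourhood in `H` of the new vertex `x = none`. -/
def newNeighbors {V : Type*} (H : SimpleGraph (Option V)) : Set V :=
  {y | H.Adj none (some y)}

namespace Cotree

variable {V : Type*} {G : SimpleGraph V} (T : Cotree G)

/-- `V(u)`: the vertices carried by the leaves of the subtree rooted at `u`. -/
def verts (u : T.tree) : Set V := {x | u ≤ T.leaf x}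

/-- `u` is full with respect to the neighbourhood `N`. -/
def IsFull (N : Set V) (u : T.tree) : Prop := T.verts u ⊆ N

/-- `u` is hollow with respect to the neighbourhood `N`. -/
def IsHollow (N : Set V) (u : T.tree) : Prop := T.verts u ∩ N = ∅

/-- `u` is uniform with respect to the neighbourhood `N`. -/
def IsUniform (N : Set V) (u : T.tree) : Prop := T.IsFull N u ∨ T.IsHollow N u

/-- `u` is mixed with respect to the neighbourhood `N`. -/
def IsMixed (N : Set V) (u : T.tree) : Prop := ¬ T.IsFull N u ∧ ¬ T.IsHollow N u

/-- `u` is the insertion node for a new vertex whose neighbourhood is `N`. -/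
def IsInsertionNode (N : Set V) (u : T.tree) : Prop :=
  T.IsMixed N u ∧
  (∀ v : T.tree, u ⋖ v → T.IsUniform N v) ∧
  ∀ y : V, y ∉ T.verts u → (y ∈ N ↔ T.kind (T.leaf y ⊓ u) = NodeKind.series)

/-- `u` is the insertion node associated to some minimal constrained completion of `G + x`, where
the new vertex `x` has neighbourhood `N`. -/
def IsCompletionMinimalInsertionNode (N : Set V) (u : T.tree) : Prop :=
  ∃ H : SimpleGraph (Option V),
    IsMinimalConstrainedCompletion G N H ∧ T.IsInsertionNode (newNeighbors H) u

/-- `u` is eligible: for every strict ancestor `v` of `u` that is a parallel node, all the children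
of `v` that are not ancestors of `u` are hollow. -/
def IsEligible (N : Set V) (u : T.tree) : Prop :=
  ∀ v : T.tree, v < u → T.kind v = NodeKind.parallel →
    ∀ w : T.tree, v ⋖ w → ¬ w ≤ u → T.IsHollow N w

/-- Completion-forced nodes. -/
inductive IsCompletionForced (N : Set V) : T.tree → Prop
  | full (u : T.tree) (h : T.IsFull N u) : IsCompletionForced N u
  | parallel (u : T.tree) (hu : T.kind u = NodeKind.parallel)
      (h : ∀ v : T.tree, u ⋖ v → ¬ T.IsHollow N v) : IsCompletionForced N u
  | series (u : T.tree) (hu : T.kind u = NodeKind.series)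
      (h : ∀ v : T.tree, u ⋖ v → IsCompletionForced N v) : IsCompletionForced N u

end Cotree

/-!
Call a set `M` of vertices coherent if, for every node `u` that is mixed with respect to `M`, the
set `M` consists outside `V(u)` of the vertices whose lowest common ancestor with `u` is a series
node. For a cograph `G`, the sets `M` such that `G + x` with `N(x) = M` is a cograph are the
coherent ones, so a minimal constrained completion is a minimal coherent set containing `N`.

A coherent set can be replaced inside `V(u)` by any other coherent set once everything outside
`V(u)` is reset according to lowest common ancestors with `u`; the result contains `N` as soon as
`u` is eligible. Since a node `v` that is not completion-forced has a vertex of `V(v)` outside some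
coherent set containing `V(v) ∩ N`, this replacement shrinks every completion that violates the
conditions of the theorem. Conversely, under these conditions, the set that fills the non-hollow
children of `u` is coherent, and a smaller coherent set containing `N` has no mixed child of `u`,
hence equals it.
-/

section Graph

variable {V : Type*} {G : SimpleGraph V} {N M : Set V}

theorem isCograph_iff_forall_adj :
    IsCograph G ↔ ∀ a b c d, G.Adj a b → G.Adj b c → G.Adj c d →
      ¬ G.Adj a c → ¬ G.Adj b d → G.Adj a d := by
  constructor
  · intro hG a b c d hab hbc hcd hac hbd
    by_contra had
    have map_adj (i j : Fin 4) : G.Adj (![a, b, c, d] i) (![a, b, c, d] j) ↔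
        (SimpleGraph.pathGraph 4).Adj i j := by
      fin_cases i <;> fin_cases j <;>
        simp [SimpleGraph.pathGraph_adj, G.adj_comm, hab, hbc, hcd, hac, hbd, had]
    -- An induced copy is injective because distinct vertices of the path have distinct neighbours.
    have path_twin_free : ∀ i j : Fin 4, (∀ k, (SimpleGraph.pathGraph 4).Adj i k ↔
        (SimpleGraph.pathGraph 4).Adj j k) → i = j := by
      simp only [SimpleGraph.pathGraph_adj]
      decide
    refine hG ⟨⟨⟨![a, b, c, d], fun i j hij => path_twin_free i j fun k => ?_⟩, map_adj _ _⟩⟩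
    rw [← map_adj, ← map_adj, hij]
  · rintro h ⟨e⟩
    have := h (e 0) (e 1) (e 2) (e 3)
    simp [SimpleGraph.pathGraph_adj] at this

theorem IsCograph.mem_iff_adj_of_addVertex (h : IsCograph (addVertex G M)) {a b c : V}
    (hb : G.Adj a b ↔ G.Adj c b) (hac : ¬ (G.Adj a c ↔ G.Adj a b)) (hM : ¬ (a ∈ M ↔ c ∈ M)) :
    b ∈ M ↔ G.Adj a b := by
  rw [isCograph_iff_forall_adj] at h
  wlog ha : a ∈ M generalizing a c
  · rw [hb]
    exact this hb.symm (by rwa [G.adj_comm, ← hb]) (by tauto) (by tauto)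
  by_cases hab : G.Adj a b
  · have hbM : b ∈ M := by
      by_contra hbM
      have := h none (some a) (some b) (some c) ha hab (hb.1 hab).symm hbM
      exact absurd (this (by tauto)) (by tauto)
    exact iff_of_true hbM hab
  · refine iff_of_false (fun hbM => hab ?_) hab
    have := h (some b) none (some a) (some c) hbM ha (by tauto) (mt G.adj_symm hab)
    exact absurd (hb.2 (G.adj_symm (this (by tauto)))) hab

-- Since the path on four vertices is self-complementary, the four ways in which `x` and three
-- vertices of `G` can form such a path are covered by one condition.
theorem IsCograph.addVertex_of_forall (hG : IsCograph G)
    (h : ∀ a b c, (G.Adj a b ↔ G.Adj c b) → ¬ (G.Adj a c ↔ G.Adj a b) → ¬ (a ∈ M ↔ c ∈ M) →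
      (b ∈ M ↔ G.Adj a b)) : IsCograph (addVertex G M) := by
  rw [isCograph_iff_forall_adj] at hG ⊢
  rintro (_ | a) (_ | b) (_ | c) (_ | d) hab hbc hcd hac hbd
  all_goals simp only [addVertex] at *
  · exact hcd
  · exact hac hcd
  · by_contra hd
    exact hac ((h b c d (iff_of_true hbc hcd.symm) (by tauto) (by tauto)).2 hbc)
  · exact hab
  · by_contra had
    have hca := mt G.adj_symm hac
    have hda := mt G.adj_symm had
    exact hca ((h c a d (iff_of_false hca hda) (by tauto) (by tauto)).1 hab)
  · by_contra had
    exact had ((h a d b (iff_of_false had hbd) (by tauto) (by tauto)).1 hcd)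
  · by_contra ha
    have hca := mt G.adj_symm hac
    exact hbd ((h c b a (iff_of_true hbc.symm hab) (by tauto) (by tauto)).2 hbc.symm)
  · exact hG a b c d hab hbc hcd hac hbd

theorem addVertex_le_addVertex_iff : addVertex G N ≤ addVertex G M ↔ N ⊆ M := by
  constructor
  · exact fun h y hy => h (show (addVertex G N).Adj none (some y) from hy)
  · rintro h (_ | a) (_ | b) hab
    exacts [hab, h hab, h hab, hab]

theorem IsConstrainedCompletion.addVertex_newNeighbors {H : SimpleGraph (Option V)}
    (h : IsConstrainedCompletion G N H) : addVertex G (newNeighbors H) = H := by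
  ext (_ | a) (_ | b)
  · exact iff_of_false id (H.loopless.irrefl _)
  · exact Iff.rfl
  · exact H.adj_comm _ _
  · exact ⟨fun hab => h.2.1 (show (addVertex G N).Adj (some a) (some b) from hab), h.2.2 a b⟩

theorem isConstrainedCompletion_addVertex_iff :
    IsConstrainedCompletion G N (addVertex G M) ↔ IsCograph (addVertex G M) ∧ N ⊆ M :=
  and_congr_right' ((and_iff_left fun _ _ => id).trans addVertex_le_addVertex_iff)

theorem isMinimalConstrainedCompletion_addVertex_iff :
    IsMinimalConstrainedCompletion G N (addVertex G M) ↔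
      Minimal (fun M => IsCograph (addVertex G M) ∧ N ⊆ M) M := by
  simp only [← isConstrainedCompletion_addVertex_iff]
  exact (OrderEmbedding.ofMapLEIff (addVertex G) fun _ _ =>
    addVertex_le_addVertex_iff).minimal_apply_mem_iff (t := {H | IsConstrainedCompletion G N H})
      fun H hH => ⟨newNeighbors H, hH.addVertex_newNeighbors⟩

end Graph

section Tree

theorem eq_of_covBy_of_covBy_of_le {α : Type*} [PartialOrder α] [PredOrder α]
    [IsPredArchimedean α] {u v w y : α} (hv : u ⋖ v) (hw : u ⋖ w) (hvy : v ≤ y) (hwy : w ≤ y) :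
    v = w := by
  rcases le_total_of_directed hwy hvy with h | h
  · exact (hw.eq_or_eq hv.le h).resolve_left hv.ne'
  · exact ((hv.eq_or_eq hw.le h).resolve_left hw.ne').symm

variable {α : Type*} [SemilatticeInf α] [PredOrder α] [IsPredArchimedean α] {a b c u v w y : α}

theorem inf_eq_inf_of_le_of_not_le (huw : u ≤ w) (huy : ¬ u ≤ y) : y ⊓ w = y ⊓ u := by
  have h : y ⊓ w ≤ u := (le_total_of_directed inf_le_right huw).resolve_left
    fun h => huy (h.trans inf_le_left)
  exact le_antisymm (le_inf inf_le_left h) (inf_le_inf_left y huw)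

theorem inf_eq_of_covBy_of_not_le (hw : v ⋖ w) (hwy : w ≤ y) (hvu : v ≤ u) (hwu : ¬ w ≤ u) :
    y ⊓ u = v := by
  rw [inf_comm, inf_eq_inf_of_le_of_not_le hwy hwu]
  exact (hw.eq_or_eq (le_inf hvu hw.le) inf_le_right).resolve_right
    fun h => hwu (h ▸ inf_le_left)

theorem inf_eq_inf_or_inf_eq_inf_of_inf_le (h : a ⊓ c ≤ b) :
    a ⊓ b = a ⊓ c ∨ c ⊓ b = a ⊓ c := by
  have hab : a ⊓ c ≤ a ⊓ b := le_inf inf_le_left h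
  have hcb : a ⊓ c ≤ c ⊓ b := le_inf inf_le_right h
  rcases le_total_of_directed (inf_le_right : c ⊓ b ≤ b) (inf_le_right : a ⊓ b ≤ b) with h | h
  · exact .inl (le_antisymm (le_inf inf_le_left (h.trans inf_le_left)) hab)
  · exact .inr (le_antisymm (le_inf (h.trans inf_le_left) inf_le_left) hcb)

end Tree

namespace Cotree

variable {V : Type*} {G : SimpleGraph V} {T : Cotree G} {N M A : Set V} {u v w : T.tree} {x y : V}

instance : Finite T.tree := T.finite_tree

theorem kind_leaf (x : V) : T.kind (T.leaf x) = .leaf :=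
  (T.kind_eq_leaf_iff _).2 ⟨x, rfl⟩

theorem kind_ne_leaf_of_lt (h : u < v) : T.kind u ≠ .leaf := fun hu =>
  let ⟨w, hw, _⟩ := exists_covBy_le_of_lt h
  T.not_covBy_of_leaf u w hu hw

theorem kind_eq_parallel (h₁ : T.kind u ≠ .leaf) (h₂ : T.kind u ≠ .series) :
    T.kind u = .parallel := by
  cases h : T.kind u <;> simp_all

theorem kind_eq_series_iff_of_covBy (h : u ⋖ v) (hv : T.kind v ≠ .leaf) :
    T.kind v = .series ↔ T.kind u ≠ .series := by
  have hu := kind_ne_leaf_of_lt h.lt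
  have huv := T.kind_ne_of_covBy u v h
  cases hku : T.kind u <;> cases hkv : T.kind v <;> simp_all

theorem adj_iff_kind_inf : G.Adj x y ↔ T.kind (T.leaf x ⊓ T.leaf y) = .series := by
  rcases eq_or_ne x y with rfl | h
  · simp [kind_leaf]
  · exact T.adj_iff x y h

theorem exists_covBy_ne (hu : T.kind u ≠ .leaf) (v : T.tree) : ∃ w, u ⋖ w ∧ w ≠ v := by
  obtain ⟨a, b, ha, hb, hab⟩ := T.two_children u hu
  by_cases h : a = v
  · exact ⟨b, hb, h ▸ hab.symm⟩
  · exact ⟨a, ha, h⟩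

theorem verts_anti (h : u ≤ v) : T.verts v ⊆ T.verts u := fun _ hy => h.trans hy

theorem verts_leaf (x : V) : T.verts (T.leaf x) = {x} := by
  refine Set.eq_singleton_iff_unique_mem.2 ⟨le_rfl, fun y hy => T.leaf_injective ?_⟩
  by_contra h
  exact kind_ne_leaf_of_lt (lt_of_le_of_ne hy (Ne.symm h)) (kind_leaf x)

theorem verts_nonempty (u : T.tree) : (T.verts u).Nonempty := by
  obtain ⟨v, huv, hv⟩ := Finite.exists_le_maximal (p := fun _ : T.tree => True) (a := u) trivial
  have hk : T.kind v = .leaf := by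
    by_contra hk
    obtain ⟨w, -, hw, -⟩ := T.two_children v hk
    exact hv.not_prop_of_gt hw.lt trivial
  obtain ⟨x, rfl⟩ := (T.kind_eq_leaf_iff v).1 hk
  exact ⟨x, huv⟩

theorem exists_covBy_mem_verts (hu : T.kind u ≠ .leaf) (hy : y ∈ T.verts u) :
    ∃ v, u ⋖ v ∧ y ∈ T.verts v :=
  exists_covBy_le_of_lt (lt_of_le_of_ne hy fun h => hu (h ▸ kind_leaf y))

theorem isHollow_iff : T.IsHollow M u ↔ ∀ y ∈ T.verts u, y ∉ M :=
  Set.disjoint_iff_inter_eq_empty.symm.trans Set.disjoint_left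

theorem not_isHollow_iff : ¬ T.IsHollow M u ↔ ∃ y ∈ T.verts u, y ∈ M :=
  Set.nonempty_iff_ne_empty.symm

theorem not_isFull_iff : ¬ T.IsFull M u ↔ ∃ y ∈ T.verts u, y ∉ M :=
  Set.not_subset

theorem isMixed_iff :
    T.IsMixed M u ↔ (∃ a ∈ T.verts u, a ∈ M) ∧ ∃ b ∈ T.verts u, b ∉ M := by
  rw [IsMixed, not_isFull_iff, not_isHollow_iff, and_comm]

theorem not_isMixed_iff : ¬ T.IsMixed M u ↔ T.IsUniform M u := by
  rw [IsMixed, IsUniform]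
  tauto

theorem IsHollow.anti (h : T.IsHollow M u) (hN : N ⊆ M) : T.IsHollow N u :=
  isHollow_iff.2 fun y hy hyN => isHollow_iff.1 h y hy (hN hyN)

theorem IsMixed.anti (h : T.IsMixed M v) (huv : u ≤ v) : T.IsMixed M u :=
  ⟨fun hf => h.1 ((verts_anti huv).trans hf),
    fun hh => h.2 (isHollow_iff.2 fun y hy => isHollow_iff.1 hh y (verts_anti huv hy))⟩

theorem isUniform_of_kind_eq_leaf (hu : T.kind u = .leaf) : T.IsUniform M u := by
  obtain ⟨x, rfl⟩ := (T.kind_eq_leaf_iff u).1 hu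
  simp only [IsUniform, IsFull, isHollow_iff, verts_leaf, Set.singleton_subset_iff,
    Set.mem_singleton_iff, forall_eq]
  exact em (x ∈ M)

theorem IsMixed.kind_ne_leaf (h : T.IsMixed M u) : T.kind u ≠ .leaf := fun hu =>
  not_isMixed_iff.2 (isUniform_of_kind_eq_leaf hu) h

theorem IsMixed.exists_inf_eq (h : T.IsMixed M u) :
    ∃ a ∈ M, ∃ b ∉ M, T.leaf a ⊓ T.leaf b = u := by
  obtain ⟨⟨a, ha, haM⟩, b, hb, hbM⟩ := isMixed_iff.1 h
  obtain ⟨v, hv, hva⟩ := exists_covBy_mem_verts h.kind_ne_leaf ha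
  by_cases hvb : b ∈ T.verts v
  · obtain ⟨w, hw, hwv⟩ := exists_covBy_ne h.kind_ne_leaf v
    obtain ⟨e, he⟩ := verts_nonempty w
    have hve : ¬ v ≤ T.leaf e := fun h' => hwv (eq_of_covBy_of_covBy_of_le hw hv he h')
    have hue : u ≤ T.leaf e := hw.le.trans he
    by_cases heM : e ∈ M
    · exact ⟨e, heM, b, hbM, inf_comm _ _ |>.trans (inf_eq_of_covBy_of_not_le hv hvb hue hve)⟩
    · exact ⟨a, haM, e, heM, inf_eq_of_covBy_of_not_le hv hva hue hve⟩
  · exact ⟨a, haM, b, hbM, inf_eq_of_covBy_of_not_le hv hva hb hvb⟩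

/-- The last condition in the definition of an insertion node: a new vertex with neighbourhood `M`
is attached at `u` if, outside `V(u)`, it is adjacent to exactly the vertices that are adjacent to
those of `V(u)`. -/
def IsAttachedAt (T : Cotree G) (M : Set V) (u : T.tree) : Prop :=
  ∀ y, y ∉ T.verts u → (y ∈ M ↔ T.kind (T.leaf y ⊓ u) = .series)

theorem IsInsertionNode.isAttachedAt (h : T.IsInsertionNode M u) : T.IsAttachedAt M u := h.2.2

theorem IsAttachedAt.of_le (h : T.IsAttachedAt M u) (hvu : v ≤ u) : T.IsAttachedAt M v :=
  fun y hy => by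
    rw [h y (mt (verts_anti hvu ·) hy), inf_eq_inf_of_le_of_not_le hvu hy]

theorem IsAttachedAt.isUniform (h : T.IsAttachedAt M u) (hvu : ¬ v ≤ u) (huv : ¬ u ≤ v) :
    T.IsUniform M v := by
  have mem_iff (y) (hy : y ∈ T.verts v) : y ∈ M ↔ T.kind (u ⊓ v) = .series := by
    rw [h y fun hu => (le_total_of_directed hy hu).elim huv hvu, inf_comm,
      inf_eq_inf_of_le_of_not_le hy hvu]
  by_cases hk : T.kind (u ⊓ v) = .series
  · exact .inl fun y hy => (mem_iff y hy).2 hk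
  · exact .inr (isHollow_iff.2 fun y hy => mt (mem_iff y hy).1 hk)

theorem IsAttachedAt.mem_iff_of_covBy (h : T.IsAttachedAt M v) (hv : u ⋖ v) (hy : y ∈ T.verts u)
    (hyv : y ∉ T.verts v) : y ∈ M ↔ T.kind u = .series := by
  rw [h y hyv, inf_comm, inf_eq_of_covBy_of_not_le hv le_rfl hy hyv]

/-- A set `M` is coherent if it could be the neighbourhood of a new vertex in a cograph: the vertex
is attached at every node that it distinguishes. -/
def IsCoherent (T : Cotree G) (M : Set V) : Prop :=
  ∀ u, T.IsMixed M u → T.IsAttachedAt M u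

theorem isCoherent_of_isCograph_addVertex (h : IsCograph (addVertex G M)) :
    T.IsCoherent M := by
  intro u hu y hy
  have hlt : T.leaf y ⊓ u < u := inf_le_right.lt_of_ne fun e => hy (e ▸ inf_le_left)
  obtain ⟨c, hc, hcu⟩ := exists_covBy_le_of_lt hlt
  have hcy : ¬ c ≤ T.leaf y := fun hcy => (le_inf hcy hcu).not_gt hc.lt
  have hcM := hu.anti hcu
  obtain ⟨a, haM, b, hbM, hab⟩ := hcM.exists_inf_eq
  have inf_eq {z : V} (hz : c ≤ T.leaf z) : T.leaf z ⊓ T.leaf y = T.leaf y ⊓ u := by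
    rw [inf_comm, inf_eq_inf_of_le_of_not_le hz hcy, inf_eq_inf_of_le_of_not_le hcu hcy]
  have hay := inf_eq (hab ▸ inf_le_left : c ≤ T.leaf a)
  have hby := inf_eq (hab ▸ inf_le_right : c ≤ T.leaf b)
  have hk := kind_eq_series_iff_of_covBy hc hcM.kind_ne_leaf
  have hayb : y ∈ M ↔ G.Adj a y := h.mem_iff_adj_of_addVertex (c := b)
    (by simp only [adj_iff_kind_inf (T := T), hay, hby])
    (by simp only [adj_iff_kind_inf (T := T), hay, hab]; tauto) (by tauto)
  rw [hayb, adj_iff_kind_inf (T := T), hay]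

theorem IsCoherent.isCograph_addVertex (h : T.IsCoherent M) (hG : IsCograph G) :
    IsCograph (addVertex G M) := by
  refine hG.addVertex_of_forall fun a b c hb hac hM => ?_
  simp only [adj_iff_kind_inf (T := T)] at hb hac ⊢
  have hbu : ¬ T.leaf a ⊓ T.leaf c ≤ T.leaf b := fun hle => by
    rcases inf_eq_inf_or_inf_eq_inf_of_inf_le hle with e | e
    · exact hac (by rw [e])
    · exact hac (by rw [hb, e])
  have hmix : T.IsMixed M (T.leaf a ⊓ T.leaf c) := by
    have ha : a ∈ T.verts (T.leaf a ⊓ T.leaf c) := inf_le_left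
    have hc : c ∈ T.verts (T.leaf a ⊓ T.leaf c) := inf_le_right
    by_cases haM : a ∈ M
    · exact isMixed_iff.2 ⟨⟨a, ha, haM⟩, c, hc, by tauto⟩
    · exact isMixed_iff.2 ⟨⟨c, hc, by tauto⟩, a, ha, haM⟩
  rw [h _ hmix b hbu, ← inf_eq_inf_of_le_of_not_le inf_le_left hbu, inf_comm]

/-- `M` is the neighbourhood of the new vertex in a minimal constrained completion of `G + x`,
expressed through coherence in the cotree rather than through a graph. -/
def IsMinimalCompletion (T : Cotree G) (N M : Set V) : Prop :=
  Minimal (fun M => T.IsCoherent M ∧ N ⊆ M) M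

theorem isCompletionMinimalInsertionNode_iff (hG : IsCograph G) :
    T.IsCompletionMinimalInsertionNode N u ↔
      ∃ M, T.IsMinimalCompletion N M ∧ T.IsInsertionNode M u := by
  have isCoherent_iff (M) : T.IsCoherent M ↔ IsCograph (addVertex G M) :=
    ⟨fun h => h.isCograph_addVertex hG, isCoherent_of_isCograph_addVertex⟩
  simp only [IsMinimalCompletion, isCoherent_iff, ← isMinimalConstrainedCompletion_addVertex_iff]
  constructor
  · rintro ⟨H, hH, hu⟩
    exact ⟨newNeighbors H, hH.prop.addVertex_newNeighbors.symm ▸ hH, hu⟩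
  · rintro ⟨M, hM, hu⟩
    exact ⟨addVertex G M, hM, hu⟩

theorem isCoherent_empty : T.IsCoherent ∅ := fun _ hu =>
  absurd (Set.inter_empty _) hu.2

theorem IsAttachedAt.isCoherent (h : T.IsAttachedAt M u)
    (hbelow : ∀ v, u < v → T.IsMixed M v → T.IsAttachedAt M v) : T.IsCoherent M := by
  intro v hv
  by_cases hvu : v ≤ u
  · exact h.of_le hvu
  by_cases huv : u ≤ v
  · exact hbelow v (lt_of_le_not_ge huv hvu) hv
  · exact absurd hv (not_isMixed_iff.2 (h.isUniform hvu huv))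

theorem isEligible_iff :
    T.IsEligible N u ↔ ∀ y ∈ N, y ∉ T.verts u → T.kind (T.leaf y ⊓ u) = .series := by
  constructor
  · intro h y hyN hy
    have hlt : T.leaf y ⊓ u < u := inf_le_right.lt_of_ne fun e => hy (e ▸ inf_le_left)
    have hleaf := kind_ne_leaf_of_lt hlt
    obtain ⟨w, hw, hyw⟩ := exists_covBy_mem_verts hleaf inf_le_left
    have hwu : ¬ w ≤ u := fun hwu => (le_inf hyw hwu).not_gt hw.lt
    by_contra hk
    exact isHollow_iff.1 (h _ hlt (kind_eq_parallel hleaf hk) w hw hwu) y hyw hyN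
  · intro h v hvu hk w hw hwu
    refine isHollow_iff.2 fun y hyw hyN => ?_
    have hinf : T.leaf y ⊓ u = v := inf_eq_of_covBy_of_not_le hw hyw hvu.le hwu
    have := h y hyN fun hy => hvu.ne (hinf ▸ inf_eq_right.2 hy)
    simp [hinf, hk] at this

theorem IsAttachedAt.isEligible (h : T.IsAttachedAt M u) (hN : N ⊆ M) : T.IsEligible N u :=
  isEligible_iff.2 fun y hyN hy => (h y hy).1 (hN hyN)

theorem IsEligible.subset_of_isAttachedAt (hu : T.IsEligible N u) (hM : T.IsAttachedAt M u)
    (h : T.verts u ∩ N ⊆ M) : N ⊆ M := fun y hyN => by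
  by_cases hy : y ∈ T.verts u
  · exact h ⟨hy, hyN⟩
  · exact (hM y hy).2 (isEligible_iff.1 hu y hyN hy)

theorem IsEligible.isHollow_of_covBy (h : T.IsEligible N v) (hk : T.kind u = .parallel)
    (hv : u ⋖ v) (hvN : T.IsHollow N v) : T.IsHollow N u := by
  refine isHollow_iff.2 fun y hy hyN => ?_
  have hyv : y ∉ T.verts v := fun hyv => isHollow_iff.1 hvN y hyv hyN
  have := isEligible_iff.1 h y hyN hyv
  rw [inf_comm, inf_eq_of_covBy_of_not_le hv le_rfl hy hyv] at this
  simp [hk] at this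

/-- The neighbourhood of a new vertex that is attached at `u` and has the neighbourhood `A` inside
`V(u)`. -/
def attach (T : Cotree G) (u : T.tree) (A : Set V) : Set V :=
  (T.verts u).ite A {y | T.kind (T.leaf y ⊓ u) = .series}

theorem mem_attach_of_mem (hy : y ∈ T.verts u) : y ∈ T.attach u A ↔ y ∈ A := by
  simp [attach, Set.ite, hy]

theorem isAttachedAt_attach : T.IsAttachedAt (T.attach u A) u := fun y hy => by
  simp [attach, Set.ite, hy]

theorem IsAttachedAt.attach_subset (h : T.IsAttachedAt M u) (hA : T.verts u ∩ A ⊆ M) :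
    T.attach u A ⊆ M := fun y hyA => by
  by_cases hy : y ∈ T.verts u
  · exact hA ⟨hy, (mem_attach_of_mem hy).1 hyA⟩
  · rwa [h y hy, ← isAttachedAt_attach y hy]

theorem isMixed_attach_iff_of_le (h : u ≤ v) : T.IsMixed (T.attach u A) v ↔ T.IsMixed A v := by
  have mem_iff (y) (hy : y ∈ T.verts v) := mem_attach_of_mem (A := A) (verts_anti h hy)
  simp only [isMixed_iff]
  exact and_congr (exists_congr fun y => and_congr_right (mem_iff y))
    (exists_congr fun y => and_congr_right fun hy => not_congr (mem_iff y hy))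

theorem IsCoherent.attach (hA : T.IsCoherent A) (u : T.tree) : T.IsCoherent (T.attach u A) := by
  refine isAttachedAt_attach.isCoherent fun v huv hv y hyv => ?_
  by_cases hyu : y ∈ T.verts u
  · rw [mem_attach_of_mem hyu, hA v ((isMixed_attach_iff_of_le huv.le).1 hv) y hyv]
  · rw [isAttachedAt_attach y hyu, inf_eq_inf_of_le_of_not_le huv.le hyu]

/-- The neighbourhood of a new vertex that is attached at `u` and whose neighbours inside `V(u)`
are the leaves below the non-hollow children of `u`. -/
def fillChildren (T : Cotree G) (N : Set V) (u : T.tree) : Set V :=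
  T.attach u {y | ∃ v, u ⋖ v ∧ ¬ T.IsHollow N v ∧ y ∈ T.verts v}

theorem mem_fillChildren_of_covBy (hv : u ⋖ v) (hy : y ∈ T.verts v) :
    y ∈ T.fillChildren N u ↔ ¬ T.IsHollow N v := by
  rw [fillChildren, mem_attach_of_mem (verts_anti hv.le hy)]
  refine ⟨?_, fun hvN => ⟨v, hv, hvN, hy⟩⟩
  rintro ⟨w, hw, hwN, hyw⟩
  rwa [eq_of_covBy_of_covBy_of_le hv hw hy hyw]

theorem isUniform_fillChildren (hv : u ⋖ v) : T.IsUniform (T.fillChildren N u) v := by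
  by_cases h : T.IsHollow N v
  · exact .inr (isHollow_iff.2 fun y hy hyM => (mem_fillChildren_of_covBy hv hy).1 hyM h)
  · exact .inl fun y hy => (mem_fillChildren_of_covBy hv hy).2 h

theorem isCoherent_fillChildren : T.IsCoherent (T.fillChildren N u) := by
  refine isAttachedAt_attach.isCoherent fun v huv hv => ?_
  obtain ⟨w, hw, hwv⟩ := exists_covBy_le_of_lt huv
  exact absurd (hv.anti hwv) (not_isMixed_iff.2 (isUniform_fillChildren hw))

theorem verts_inter_subset_fillChildren (hu : T.kind u ≠ .leaf) :
    T.verts u ∩ N ⊆ T.fillChildren N u := by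
  rintro y ⟨hy, hyN⟩
  obtain ⟨v, hv, hyv⟩ := exists_covBy_mem_verts hu hy
  exact (mem_fillChildren_of_covBy hv hyv).2 (not_isHollow_iff.2 ⟨y, hyv, hyN⟩)

theorem not_isFull_fillChildren (hv : u ⋖ v) (hvN : T.IsHollow N v) :
    ¬ T.IsFull (T.fillChildren N u) u := fun hfull =>
  let ⟨_, hy⟩ := verts_nonempty v
  (mem_fillChildren_of_covBy hv hy).1 (hfull (verts_anti hv.le hy)) hvN

theorem isInsertionNode_fillChildren (hu : ¬ T.IsHollow N u) (hv : u ⋖ v)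
    (hvN : T.IsHollow N v) : T.IsInsertionNode (T.fillChildren N u) u := by
  refine ⟨⟨not_isFull_fillChildren hv hvN, ?_⟩, fun w => isUniform_fillChildren,
    isAttachedAt_attach⟩
  obtain ⟨y, hy⟩ := not_isHollow_iff.1 hu
  exact not_isHollow_iff.2
    ⟨y, hy.1, verts_inter_subset_fillChildren (kind_ne_leaf_of_lt hv.lt) hy⟩

theorem IsCompletionForced.isFull (h : T.IsCompletionForced N u) (hM : T.IsCoherent M)
    (hN : N ⊆ M) : T.IsFull M u := by
  induction h with
  | full u h => exact h.trans hN
  | parallel u hk h =>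
    intro y hy
    have hu : T.kind u ≠ .leaf := by simp [hk]
    by_contra hyM
    obtain ⟨v, hv, hyv⟩ := exists_covBy_mem_verts hu hy
    have hmix : T.IsMixed M v :=
      ⟨not_isFull_iff.2 ⟨y, hyv, hyM⟩, fun hvM => h v hv (hvM.anti hN)⟩
    obtain ⟨w, hw, hwv⟩ := exists_covBy_ne hu v
    obtain ⟨z, hzw, hzN⟩ := not_isHollow_iff.1 (h w hw)
    have hzv : z ∉ T.verts v := fun hzv => hwv (eq_of_covBy_of_covBy_of_le hw hv hzw hzv)
    have := ((hM v hmix).mem_iff_of_covBy hv (verts_anti hw.le hzw) hzv).1 (hN hzN)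
    simp [hk] at this
  | series u hk _ ih =>
    intro y hy
    obtain ⟨v, hv, hyv⟩ := exists_covBy_mem_verts (by simp [hk]) hy
    exact ih v hv hyv

theorem exists_isCoherent_not_isFull (hu : ¬ T.IsCompletionForced N u) :
    ∃ A, T.IsCoherent A ∧ T.verts u ∩ N ⊆ A ∧ ¬ T.IsFull A u := by
  induction u using WellFoundedGT.induction with | ind u ih
  rcases hk : T.kind u with _ | _ | _
  · have hhol : T.IsHollow N u :=
      (isUniform_of_kind_eq_leaf hk).resolve_left fun hf => hu (.full u hf)
    exact ⟨∅, isCoherent_empty, hhol.subset,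
      fun hf => (verts_nonempty u).ne_empty (Set.subset_empty_iff.1 hf)⟩
  · obtain ⟨v, hv, hvN⟩ : ∃ v, u ⋖ v ∧ T.IsHollow N v := by
      by_contra! h
      exact hu (.parallel u hk h)
    exact ⟨T.fillChildren N u, isCoherent_fillChildren,
      verts_inter_subset_fillChildren (by simp [hk]), not_isFull_fillChildren hv hvN⟩
  · obtain ⟨v, hv, hvN⟩ : ∃ v, u ⋖ v ∧ ¬ T.IsCompletionForced N v := by
      by_contra! h
      exact hu (.series u hk h)
    obtain ⟨A, hA, hNA, hfull⟩ := ih v hv.lt hvN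
    refine ⟨T.attach v A, hA.attach v, fun y hy => ?_, fun hf => hfull fun y hy => ?_⟩
    · by_cases hyv : y ∈ T.verts v
      · exact (mem_attach_of_mem hyv).2 (hNA ⟨hyv, hy.2⟩)
      · exact (isAttachedAt_attach.mem_iff_of_covBy hv hy.1 hyv).2 hk
    · exact (mem_attach_of_mem hy).1 (hf (verts_anti hv.le hy))

theorem IsMinimalCompletion.inter_verts_subset (hM : T.IsMinimalCompletion N M)
    (hu : T.IsEligible N u) (hA : T.IsCoherent A) (hNA : T.verts u ∩ N ⊆ A)
    (hle : T.attach u A ⊆ M) : T.verts u ∩ M ⊆ A := by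
  have hN : N ⊆ T.attach u A := hu.subset_of_isAttachedAt isAttachedAt_attach
    fun y hy => (mem_attach_of_mem hy.1).2 (hNA hy)
  exact fun y hy => (mem_attach_of_mem hy.1).1 (hM.2 ⟨hA.attach u, hN⟩ hle hy.2)

theorem IsInsertionNode.not_isHollow (h : T.IsInsertionNode M u)
    (hM : T.IsMinimalCompletion N M) : ¬ T.IsHollow N u := fun hu =>
  h.1.2 <| Set.subset_empty_iff.1 <| hM.inter_verts_subset (h.isAttachedAt.isEligible hM.prop.2)
    isCoherent_empty hu.subset (h.isAttachedAt.attach_subset (by simp))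

theorem attach_subset_of_covBy (hM : T.IsAttachedAt M u) (hk : T.kind u = .parallel) (hv : u ⋖ v)
    (hfull : T.IsFull M v) : T.attach v A ⊆ M := by
  intro y hy
  by_cases hyv : y ∈ T.verts v
  · exact hfull hyv
  have hyu : y ∉ T.verts u := fun hyu => by
    simpa [hk] using (isAttachedAt_attach.mem_iff_of_covBy hv hyu hyv).1 hy
  rwa [hM y hyu, ← isAttachedAt_attach.of_le hv.le y hyu]

theorem IsInsertionNode.isCompletionForced_of_covBy (h : T.IsInsertionNode M u)
    (hM : T.IsMinimalCompletion N M) (hk : T.kind u = .parallel) (hv : u ⋖ v)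
    (hel : T.IsEligible N v) : T.IsCompletionForced N v := by
  have hfull : T.IsFull M v := (h.2.1 v hv).resolve_right fun hvM =>
    h.not_isHollow hM (hel.isHollow_of_covBy hk hv (hvM.anti hM.prop.2))
  by_contra hforced
  obtain ⟨A, hA, hNA, hAfull⟩ := exists_isCoherent_not_isFull hforced
  have := hM.inter_verts_subset hel hA hNA (attach_subset_of_covBy h.isAttachedAt hk hv hfull)
  exact hAfull fun y hy => this ⟨hy, hfull hy⟩

theorem IsInsertionNode.exists_covBy_isHollow (h : T.IsInsertionNode M u) (hN : N ⊆ M) :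
    ∃ v, u ⋖ v ∧ T.IsHollow N v := by
  obtain ⟨y, hy, hyM⟩ := not_isFull_iff.1 h.1.1
  obtain ⟨v, hv, hyv⟩ := exists_covBy_mem_verts h.1.kind_ne_leaf hy
  exact ⟨v, hv, ((h.2.1 v hv).resolve_left fun hf => hyM (hf hyv)).anti hN⟩

theorem IsEligible.isMinimalCompletion_fillChildren (hel : T.IsEligible N u)
    (hu : ¬ T.IsHollow N u) (hv : u ⋖ v) (hvN : T.IsHollow N v)
    (hunif : ∀ M, T.IsCoherent M → N ⊆ M → M ⊆ T.fillChildren N u →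
      ∀ w, u ⋖ w → T.IsUniform M w) :
    T.IsMinimalCompletion N (T.fillChildren N u) := by
  have hleaf := kind_ne_leaf_of_lt hv.lt
  refine ⟨⟨isCoherent_fillChildren, hel.subset_of_isAttachedAt isAttachedAt_attach
    (verts_inter_subset_fillChildren hleaf)⟩, ?_⟩
  rintro M ⟨hM, hNM⟩ hle y hy
  by_cases hyu : y ∈ T.verts u
  · obtain ⟨w, hw, hyw⟩ := exists_covBy_mem_verts hleaf hyu
    have hwN := (mem_fillChildren_of_covBy hw hyw).1 hy
    exact (hunif M hM hNM hle w hw).resolve_right (fun hwM => hwN (hwM.anti hNM)) hyw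
  · have hmix : T.IsMixed M u :=
      ⟨fun hf => not_isFull_fillChildren hv hvN (hf.trans hle), fun hh => hu (hh.anti hNM)⟩
    rwa [hM u hmix y hyu, ← isAttachedAt_attach y hyu]

theorem IsCoherent.isUniform_of_kind_eq_series (hM : T.IsCoherent M)
    (hle : M ⊆ T.fillChildren N u) (hk : T.kind u = .series) (hv : u ⋖ v)
    (hvN : T.IsHollow N v) (hw : u ⋖ w) : T.IsUniform M w := by
  have notMem {y : V} (hy : y ∈ T.verts v) : y ∉ M := fun hyM =>
    (mem_fillChildren_of_covBy hv hy).1 (hle hyM) hvN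
  rw [← not_isMixed_iff]
  intro hmix
  obtain ⟨y, hy⟩ := verts_nonempty v
  have hyw : y ∉ T.verts w := fun hyw => by
    obtain rfl := eq_of_covBy_of_covBy_of_le hv hw hy hyw
    exact hmix.2 (isHollow_iff.2 fun _ => notMem)
  exact notMem hy (((hM w hmix).mem_iff_of_covBy hw (verts_anti hv.le hy) hyw).2 hk)

theorem IsCoherent.isUniform_of_isCompletionForced (hM : T.IsCoherent M) (hN : N ⊆ M)
    (h : T.IsEligible N v → T.IsCompletionForced N v) : T.IsUniform M v := by
  rw [← not_isMixed_iff]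
  exact fun hmix => hmix.1 ((h ((hM v hmix).isEligible hN)).isFull hM hN)

end Cotree

theorem lemma6 {V : Type*} (G : SimpleGraph V) (hG : IsCograph G) (T : Cotree G)
    (N : Set V) (u : T.tree) :
    T.IsCompletionMinimalInsertionNode N u ↔
      T.IsEligible N u ∧ ¬ T.IsHollow N u ∧ ¬ T.IsCompletionForced N u ∧
        ((T.kind u = NodeKind.series ∧ ∃ v : T.tree, u ⋖ v ∧ T.IsHollow N v) ∨
          (T.kind u = NodeKind.parallel ∧
            ¬ ∃ v : T.tree, u ⋖ v ∧ T.IsEligible N v ∧ ¬ T.IsCompletionForced N v)) := by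
  rw [Cotree.isCompletionMinimalInsertionNode_iff hG]
  constructor
  · rintro ⟨M, hM, hu⟩
    obtain ⟨hcoh, hNM⟩ := hM.prop
    refine ⟨hu.isAttachedAt.isEligible hNM, hu.not_isHollow hM,
      fun hf => hu.1.1 (hf.isFull hcoh hNM), ?_⟩
    by_cases hk : T.kind u = .series
    · exact .inl ⟨hk, hu.exists_covBy_isHollow hNM⟩
    · have hk' := Cotree.kind_eq_parallel hu.1.kind_ne_leaf hk
      exact .inr ⟨hk', fun ⟨v, hv, hel, hnf⟩ => hnf (hu.isCompletionForced_of_covBy hM hk' hv hel)⟩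
  · rintro ⟨hel, hhol, hnf, ⟨hk, v, hv, hvN⟩ | ⟨hk, hno⟩⟩
    · refine ⟨_, hel.isMinimalCompletion_fillChildren hhol hv hvN fun M hM _ hle w hw => ?_,
        Cotree.isInsertionNode_fillChildren hhol hv hvN⟩
      exact hM.isUniform_of_kind_eq_series hle hk hv hvN hw
    · obtain ⟨v, hv, hvN⟩ : ∃ v, u ⋖ v ∧ T.IsHollow N v := by
        by_contra! h
        exact hnf (.parallel u hk h)
      refine ⟨_, hel.isMinimalCompletion_fillChildren hhol hv hvN fun M hM hNM _ w hw => ?_,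
        Cotree.isInsertionNode_fillChildren hhol hv hvN⟩
      exact hM.isUniform_of_isCompletionForced hNM fun hwel =>
        by_contra fun hwf => hno ⟨w, hw, hwel, hwf⟩
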